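/- All graphs are finite and simple. For a vertex $u$ of a graph $G$, let $N_G(u)$ be its neighborhood and $d_G(u)$ its degree, and let $$C_u(G)=\begin{cases}\dfrac{m(G[N_G(u)])}{\binom{d_G(u)}{2}}, & \text{if } d_G(u)\ge 2,\\[2mm] 0, & \text{otherwise,}\end{cases}$$ where $m(G[N_G(u)])$ is the number of edges of the subgraph of $G$ induced by $N_G(u)$. Let the clustering coefficient of a graph $G$ of order $n$ be $C(G)=\frac{1}{n}\sum_{u\in V(G)}C_u(G)$. A graph is subcubic if its maximum degree is at most $3$. If $G$ is a connected subcubic graph of order $n\ge 6$, then $$C(G)\le\begin{cases} \frac{7}{12}+\frac{12}{12n}, & \text{if } n\equiv 0 \pmod 4,\\ \frac{7}{12}+\frac{13}{12n}, & \text{if } n\equiv 1 \pmod 4,\\ \frac{7}{12}+\frac{14}{12n}, & \text{if } n\equiv 2 \pmod 4,\\ \frac{7}{12}+\frac{11}{12n}, & \text{if } n\equiv 3 \pmod 4. \end{cases}$$ -/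

import Mathlib

/-- A graph is subcubic if all its vertex degrees are at most `3`. -/
def SimpleGraph.IsSubcubic {V : Type*} (G : SimpleGraph V) [G.LocallyFinite] : Prop :=
  ∀ u : V, G.degree u ≤ 3

/-- The clustering coefficient of a vertex `u`: the size (number of edges) of the subgraph
induced by the neighbourhood of `u`, divided by `(deg u).choose 2` if `2 ≤ deg u`,
and `0` otherwise. -/
def SimpleGraph.vertexClusteringCoeff {V : Type*} [Fintype V] [DecidableEq V]
    (G : SimpleGraph V) [DecidableRel G.Adj] (u : V) : ℚ :=
  if 2 ≤ G.degree u then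
    ((G.induce (G.neighborSet u)).edgeFinset.card : ℚ) / ((G.degree u).choose 2 : ℚ)
  else 0

/-- The clustering coefficient of a finite graph: the average of the clustering coefficients
of its vertices. -/
def SimpleGraph.clusteringCoeff {V : Type*} [Fintype V] [DecidableEq V]
    (G : SimpleGraph V) [DecidableRel G.Adj] : ℚ :=
  1 / (Fintype.card V : ℚ) * ∑ u : V, G.vertexClusteringCoeff u

namespace SimpleGraph

open Finset

variable {V : Type*} [Fintype V] [DecidableEq V]

/-! Let `W` be three times the sum of the vertex coefficients, with `m` edges and `t` triangles.
Connectedness and `n > 4` exclude `K₄`, and then `t ≤ m - n + 1`: deleting an edge lying in exactly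
one triangle keeps the graph connected and lowers both sides by one. A pointwise inequality between
weight, degree and triangles at a vertex, summed with a discharging of degree-2 vertices to degree-3
ones, turns this into `4W ≤ 7n + 14`. Since `4 ∣ 4W`, rounding down gives the four residue cases. -/

omit [DecidableEq V] in
lemma Connected.eq_univ_of_forall_adj_mem {G : SimpleGraph V} (hG : G.Connected) (s : Finset V)
    (hne : s.Nonempty) (hs : ∀ x ∈ s, ∀ y, G.Adj x y → y ∈ s) : s = univ := by
  obtain ⟨x, hx⟩ := hne
  refine eq_univ_of_forall fun y => ?_
  have key : ∀ {a b : V}, G.Walk a b → a ∈ s → b ∈ s := by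
    intro a b w
    induction w with
    | nil => exact id
    | cons h _ ih => exact fun ha => ih (hs _ ha _ h)
  exact key (hG.preconnected x y).some hx

/-- The ordered triples of pairwise adjacent vertices. -/
def orderedTriangles (G : SimpleGraph V) [DecidableRel G.Adj] : Finset (V × V × V) :=
  {t | G.Adj t.1 t.2.1 ∧ G.Adj t.1 t.2.2 ∧ G.Adj t.2.1 t.2.2}

/-- The ordered pairs of adjacent neighbours of `v`. -/
def adjacentNeighborPairs (G : SimpleGraph V) [DecidableRel G.Adj] (v : V) : Finset (V × V) :=
  {t | G.Adj v t.1 ∧ G.Adj v t.2 ∧ G.Adj t.1 t.2}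

lemma eq_or_eq_or_eq_of_degree_le_three {G : SimpleGraph V} [DecidableRel G.Adj] {v : V}
    (hv : G.degree v ≤ 3) {a b c x : V} (ha : G.Adj v a) (hb : G.Adj v b) (hc : G.Adj v c)
    (hab : a ≠ b) (hac : a ≠ c) (hbc : b ≠ c) (hx : G.Adj v x) : x = a ∨ x = b ∨ x = c := by
  have hsub : ({a, b, c} : Finset V) ⊆ G.neighborFinset v := by
    intro y hy
    simp only [mem_insert, mem_singleton] at hy
    rcases hy with rfl | rfl | rfl <;> simpa
  have h3 : #({a, b, c} : Finset V) = 3 := card_eq_three.2 ⟨a, b, c, hab, hac, hbc, rfl⟩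
  have heq := eq_of_subset_of_card_le hsub (by rw [h3, card_neighborFinset_eq_degree]; exact hv)
  have : x ∈ G.neighborFinset v := by simpa
  rw [← heq] at this
  simpa using this

lemma Connected.cliqueFree_four {G : SimpleGraph V} [DecidableRel G.Adj] (hG : G.Connected)
    (hdeg : ∀ v, G.degree v ≤ 3) (hV : 4 < Fintype.card V) : G.CliqueFree 4 := by
  intro s hs
  have huniv : s = univ := by
    refine hG.eq_univ_of_forall_adj_mem s (card_pos.1 (by rw [hs.card_eq]; norm_num)) ?_
    intro x hx y hxy
    have hsub : s.erase x ⊆ G.neighborFinset x := by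
      intro z hz
      rw [mem_erase] at hz
      rw [mem_neighborFinset]
      exact hs.isClique hx hz.2 hz.1.symm
    have heq := eq_of_subset_of_card_le hsub (by
      rw [card_erase_of_mem hx, hs.card_eq, card_neighborFinset_eq_degree]; exact hdeg x)
    have : y ∈ G.neighborFinset x := by simpa
    rw [← heq] at this
    exact mem_of_mem_erase this
  have := hs.card_eq
  rw [huniv, card_univ] at this
  omega

omit [Fintype V] in
lemma isNClique_four {G : SimpleGraph V} {a b c d : V} (hab : G.Adj a b) (hac : G.Adj a c)
    (had : G.Adj a d) (hbc : G.Adj b c) (hbd : G.Adj b d) (hcd : G.Adj c d) :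
    G.IsNClique 4 {a, b, c, d} :=
  (is3Clique_triple_iff.2 ⟨hbc, hbd, hcd⟩).insert fun x hx => by
    simp only [mem_insert, mem_singleton] at hx
    rcases hx with rfl | rfl | rfl <;> assumption

/-- If `ab` lies in a second triangle `abd`, then `b, c, d` exhaust the neighbours of `a`, so a
second triangle on `ac` would need `c ~ d`, giving a `K₄`. -/
lemma CliqueFree.exists_edge_in_unique_triangle {G : SimpleGraph V} [DecidableRel G.Adj]
    (hK : G.CliqueFree 4) (hdeg : ∀ v, G.degree v ≤ 3) {a b c : V}
    (hab : G.Adj a b) (hac : G.Adj a c) (hbc : G.Adj b c) :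
    ∃ x y z, G.Adj x y ∧ G.Adj x z ∧ G.Adj y z ∧ ∀ w, G.Adj x w → G.Adj y w → w = z := by
  by_cases h : ∀ w, G.Adj a w → G.Adj b w → w = c
  · exact ⟨a, b, c, hab, hac, hbc, h⟩
  push Not at h
  obtain ⟨d, had, hbd, hdc⟩ := h
  refine ⟨a, c, b, hac, hab, hbc.symm, fun w haw hcw => ?_⟩
  rcases eq_or_eq_or_eq_of_degree_le_three (hdeg a) hab hac had hbc.ne hbd.ne hdc.symm haw
    with rfl | rfl | rfl
  · rfl
  · exact (hcw.ne rfl).elim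
  · exact (hK _ (isNClique_four hab hac had hbc hbd hcw)).elim

lemma card_edgeFinset_deleteEdges_singleton {G : SimpleGraph V} [DecidableRel G.Adj] {x y : V}
    [DecidableRel (G.deleteEdges {s(x, y)}).Adj] (hxy : G.Adj x y) :
    #(G.deleteEdges {s(x, y)}).edgeFinset + 1 = #G.edgeFinset := by
  have h : (G.deleteEdges {s(x, y)}).edgeFinset = G.edgeFinset.erase s(x, y) := by
    ext e
    simp [and_comm]
  rw [h, card_erase_add_one (by simpa)]

lemma card_orderedTriangles_le_deleteEdges {G : SimpleGraph V} [DecidableRel G.Adj] {x y z : V}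
    [DecidableRel (G.deleteEdges {s(x, y)}).Adj]
    (huniq : ∀ w, G.Adj x w → G.Adj y w → w = z) :
    #G.orderedTriangles ≤ #(G.deleteEdges {s(x, y)}).orderedTriangles + 6 := by
  have hsub : G.orderedTriangles ⊆ (G.deleteEdges {s(x, y)}).orderedTriangles ∪
      {(x, y, z), (x, z, y), (y, x, z), (y, z, x), (z, x, y), (z, y, x)} := by
    rintro ⟨u, v, w⟩ h
    simp only [orderedTriangles, mem_filter, mem_univ, true_and] at h
    simp only [orderedTriangles, mem_filter, mem_univ, true_and, mem_union, mem_insert,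
      mem_singleton, Prod.mk.injEq, deleteEdges_adj, Set.mem_singleton_iff, Sym2.eq_iff]
    have h1 := huniq u
    have h2 := huniq v
    have h3 := huniq w
    grind [G.adj_comm]
  exact (card_le_card hsub).trans ((card_union_le _ _).trans (Nat.add_le_add_left card_le_six _))

theorem Connected.six_mul_card_add_card_orderedTriangles_le {G : SimpleGraph V}
    [DecidableRel G.Adj] (hG : G.Connected) (hK : G.CliqueFree 4) (hdeg : ∀ v, G.degree v ≤ 3) :
    6 * Fintype.card V + #G.orderedTriangles ≤ 6 * #G.edgeFinset + 6 := by
  classical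
  induction hm : #G.edgeFinset using Nat.strong_induction_on generalizing G with
  | _ m ih =>
  subst hm
  rcases G.orderedTriangles.eq_empty_or_nonempty with h0 | ⟨⟨a, b, c⟩, h⟩
  · have := hG.card_vert_le_card_edgeSet_add_one
    rw [Nat.card_eq_fintype_card, Nat.card_eq_fintype_card, ← edgeFinset_card] at this
    rw [h0, card_empty]
    omega
  · simp only [orderedTriangles, mem_filter, mem_univ, true_and] at h
    obtain ⟨x, y, z, hxy, hxz, hyz, huniq⟩ :=
      hK.exists_edge_in_unique_triangle hdeg h.1 h.2.1 h.2.2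
    have hconn : (G.deleteEdges {s(x, y)}).Connected := by
      -- The path `x z y` through the rest of the triangle bypasses the deleted edge.
      refine hG.connected_delete_edge_of_not_isBridge ?_
      rw [isBridge_iff, not_not]
      have h1 : (G.deleteEdges {s(x, y)}).Adj x z := by
        simp [deleteEdges_adj, hxz, hyz.ne.symm, hxy.ne]
      have h2 : (G.deleteEdges {s(x, y)}).Adj z y := by
        simp [deleteEdges_adj, hyz.symm, hxz.ne.symm, hyz.ne.symm]
      exact h1.reachable.trans h2.reachable
    have hle : G.deleteEdges {s(x, y)} ≤ G := deleteEdges_le _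
    have hcard := card_edgeFinset_deleteEdges_singleton hxy
    have := ih _ (by omega) hconn (hK.anti hle)
      (fun v => (degree_le_of_le hle).trans (hdeg v)) rfl
    have := card_orderedTriangles_le_deleteEdges huniq
    omega

section

variable (G : SimpleGraph V) [DecidableRel G.Adj]

/-- The indicator of three vertices being pairwise adjacent. -/
def triangleIndicator (x y z : V) : ℕ :=
  if G.Adj x y ∧ G.Adj x z ∧ G.Adj y z then 1 else 0

omit [DecidableEq V] in
lemma card_adjacentNeighborPairs_eq_sum (v : V) :
    #(G.adjacentNeighborPairs v) = ∑ x, ∑ y, G.triangleIndicator v x y := by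
  rw [adjacentNeighborPairs, card_filter, ← univ_product_univ, sum_product]
  rfl

omit [DecidableEq V] in
lemma sum_card_adjacentNeighborPairs :
    ∑ v, #(G.adjacentNeighborPairs v) = #G.orderedTriangles := by
  simp_rw [card_adjacentNeighborPairs_eq_sum]
  rw [orderedTriangles, card_filter, ← univ_product_univ, sum_product]
  simp_rw [← univ_product_univ, sum_product]
  rfl

omit [DecidableEq V] in
lemma two_mul_card_edgeFinset_induce_neighborSet (v : V) :
    2 * #(G.induce (G.neighborSet v)).edgeFinset = #(G.adjacentNeighborPairs v) := by
  rw [two_mul_card_edgeFinset]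
  refine card_bij' (fun t _ => (t.1.1, t.2.1))
    (fun t ht => (⟨t.1, (mem_filter.1 ht).2.1⟩, ⟨t.2, (mem_filter.1 ht).2.2.1⟩)) ?_ ?_ ?_ ?_
  · rintro ⟨⟨a, ha⟩, ⟨b, hb⟩⟩ h
    simpa [adjacentNeighborPairs] using ⟨ha, hb, by simpa using h⟩
  · rintro ⟨a, b⟩ h
    simpa [adjacentNeighborPairs] using (mem_filter.1 h).2.2.2
  · intros; rfl
  · intros; rfl

omit [DecidableEq V] in
lemma adjacentNeighborPairs_subset_offDiag (v : V) :
    G.adjacentNeighborPairs v ⊆ (G.neighborFinset v).offDiag := by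
  rintro ⟨a, b⟩ h
  simp only [adjacentNeighborPairs, mem_filter, mem_univ, true_and] at h
  simp [mem_offDiag, h.1, h.2.1, h.2.2.ne]

omit [DecidableEq V] in
lemma card_adjacentNeighborPairs_le (v : V) :
    #(G.adjacentNeighborPairs v) ≤ G.degree v * G.degree v - G.degree v := by
  have := card_le_card (G.adjacentNeighborPairs_subset_offDiag v)
  rwa [offDiag_card, card_neighborFinset_eq_degree] at this

variable {G}

lemma CliqueFree.card_adjacentNeighborPairs_lt (hK : G.CliqueFree 4) {v : V}
    (hv : G.degree v = 3) : #(G.adjacentNeighborPairs v) < 6 := by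
  by_contra! hge
  have heq := eq_of_subset_of_card_le (G.adjacentNeighborPairs_subset_offDiag v)
    (by rw [offDiag_card, card_neighborFinset_eq_degree, hv]; exact hge)
  obtain ⟨a, b, c, hab, hac, hbc, hN⟩ :=
    card_eq_three.1 ((G.card_neighborFinset_eq_degree v).trans hv)
  have hadj : ∀ x ∈ ({a, b, c} : Finset V), ∀ y ∈ ({a, b, c} : Finset V), x ≠ y →
      G.Adj v x ∧ G.Adj v y ∧ G.Adj x y := by
    intro x hx y hy hxy
    have : (x, y) ∈ G.adjacentNeighborPairs v := by
      rw [heq, mem_offDiag, hN]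
      exact ⟨hx, hy, hxy⟩
    simpa [adjacentNeighborPairs] using this
  have h1 := hadj a (by simp) b (by simp) hab
  have h2 := hadj a (by simp) c (by simp) hac
  have h3 := hadj b (by simp) c (by simp) hbc
  exact hK _ (isNClique_four h1.1 h1.2.1 h2.2.1 h1.2.2 h2.2.2 h3.2.2)

/-- In a connected graph with more than three vertices, no triangle has all degrees two. -/
lemma Connected.exists_degree_eq_three (hG : G.Connected) (hdeg : ∀ v, G.degree v ≤ 3)
    (hV : 3 < Fintype.card V) {v x y : V} (hv : G.degree v = 2)
    (hvx : G.Adj v x) (hvy : G.Adj v y) (hxy : G.Adj x y) : G.degree x = 3 ∨ G.degree y = 3 := by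
  by_contra! hne
  have key : ∀ {a b c : V}, G.degree a ≤ 2 → G.Adj a b → G.Adj a c → b ≠ c →
      ∀ w, G.Adj a w → w = b ∨ w = c := by
    intro a b c ha hab hac hbc w hw
    have hsub : ({b, c} : Finset V) ⊆ G.neighborFinset a := by
      intro u hu
      simp only [mem_insert, mem_singleton] at hu
      rcases hu with rfl | rfl <;> simpa
    have heq := eq_of_subset_of_card_le hsub
      (by rw [card_pair hbc, card_neighborFinset_eq_degree]; exact ha)
    have : w ∈ G.neighborFinset a := by simpa
    rw [← heq] at this
    simpa using this
  have hx := hdeg x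
  have hy := hdeg y
  have huniv : ({v, x, y} : Finset V) = univ := by
    refine hG.eq_univ_of_forall_adj_mem _ (by simp) fun u hu w huw => ?_
    simp only [mem_insert, mem_singleton] at hu ⊢
    rcases hu with rfl | rfl | rfl
    · exact .inr (key hv.le hvx hvy hxy.ne w huw)
    · have := key (by omega) hvx.symm hxy hvy.ne w huw
      tauto
    · have := key (by omega) hvy.symm hxy.symm hvx.ne w huw
      tauto
  have := card_le_three (a := v) (b := x) (c := y)
  rw [huniv, card_univ] at this
  omega

lemma Connected.one_le_sum_triangleIndicator (hG : G.Connected) (hdeg : ∀ v, G.degree v ≤ 3)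
    (hV : 3 < Fintype.card V) {v : V} (hv : G.degree v = 2)
    (hne : (G.adjacentNeighborPairs v).Nonempty) :
    1 ≤ ∑ x, ∑ y, if G.degree x = 3 then G.triangleIndicator x v y else 0 := by
  obtain ⟨⟨x, y⟩, h⟩ := hne
  simp only [adjacentNeighborPairs, mem_filter, mem_univ, true_and] at h
  obtain ⟨a, b, hva, hvb, hab, ha⟩ : ∃ a b, G.Adj v a ∧ G.Adj v b ∧ G.Adj a b ∧ G.degree a = 3 := by
    rcases hG.exists_degree_eq_three hdeg hV hv h.1 h.2.1 h.2.2 with h3 | h3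
    · exact ⟨x, y, h.1, h.2.1, h.2.2, h3⟩
    · exact ⟨y, x, h.2.1, h.1, h.2.2.symm, h3⟩
  calc 1 = if G.degree a = 3 then G.triangleIndicator a v b else 0 := by
        simp [ha, triangleIndicator, hva.symm, hab, hvb]
    _ ≤ ∑ y, if G.degree a = 3 then G.triangleIndicator a v y else 0 :=
        single_le_sum (f := fun y => if G.degree a = 3 then G.triangleIndicator a v y else 0)
          (fun _ _ => Nat.zero_le _) (mem_univ b)
    _ ≤ _ := single_le_sum
          (f := fun x => ∑ y, if G.degree x = 3 then G.triangleIndicator x v y else 0)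
          (fun _ _ => Nat.zero_le _) (mem_univ a)

/-- Each degree-2 vertex in a triangle charges a degree-3 vertex `x` of that triangle; `x` is
charged at most once per ordered pair of its adjacent neighbours. -/
lemma Connected.sum_degree_two_le (hG : G.Connected) (hdeg : ∀ v, G.degree v ≤ 3)
    (hV : 3 < Fintype.card V) :
    ∑ v, (if G.degree v = 2 ∧ 0 < #(G.adjacentNeighborPairs v) then 1 else 0) ≤
      ∑ v, if G.degree v = 3 then #(G.adjacentNeighborPairs v) else 0 := by
  calc _ ≤ ∑ v, ∑ x, ∑ y, if G.degree x = 3 then G.triangleIndicator x v y else 0 := by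
        refine sum_le_sum fun v _ => ?_
        split_ifs with h
        · exact hG.one_le_sum_triangleIndicator hdeg hV h.1 (card_pos.1 h.2)
        · exact Nat.zero_le _
    _ = _ := by
        rw [sum_comm]
        refine sum_congr rfl fun x _ => ?_
        split_ifs with h
        · rw [card_adjacentNeighborPairs_eq_sum]
        · simp

variable (G) in
/-- Three times the clustering coefficient of a vertex of a subcubic graph. -/
def triangleWeight (v : V) : ℕ :=
  if G.degree v = 2 then 3 * #(G.induce (G.neighborSet v)).edgeFinset
  else if G.degree v = 3 then #(G.induce (G.neighborSet v)).edgeFinset else 0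

lemma triangleWeight_eq (hdeg : ∀ v, G.degree v ≤ 3) (v : V) :
    (G.triangleWeight v : ℚ) = 3 * G.vertexClusteringCoeff v := by
  have := hdeg v
  rw [triangleWeight, vertexClusteringCoeff]
  split_ifs with h2 h h3
  · simp [h2]
  · omega
  · rw [h3, show Nat.choose 3 2 = 3 from rfl]
    push_cast
    ring
  all_goals first | omega | simp

/-- The coefficients make this an equality at degree 3 and at degree 2 in a triangle; the two
indicator terms are the charge paid and received. -/
lemma CliqueFree.triangleWeight_le (hK : G.CliqueFree 4) (hdeg : ∀ v, G.degree v ≤ 3) (v : V) :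
    12 * G.triangleWeight v + 21 * G.degree v +
        (if G.degree v = 3 then #(G.adjacentNeighborPairs v) else 0) ≤
      63 + 7 * #(G.adjacentNeighborPairs v) +
        if G.degree v = 2 ∧ 0 < #(G.adjacentNeighborPairs v) then 1 else 0 := by
  have h3 := hdeg v
  have hle := G.card_adjacentNeighborPairs_le v
  have hlt := hK.card_adjacentNeighborPairs_lt (v := v)
  have htwo := G.two_mul_card_edgeFinset_induce_neighborSet v
  rw [triangleWeight]
  generalize #(G.induce (G.neighborSet v)).edgeFinset = τ at *
  generalize #(G.adjacentNeighborPairs v) = p at *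
  generalize G.degree v = d at *
  interval_cases d <;> simp at * <;> try split_ifs
  all_goals omega

theorem Connected.four_mul_sum_triangleWeight_le (hG : G.Connected) (hdeg : ∀ v, G.degree v ≤ 3)
    (hV : 4 < Fintype.card V) : 4 * ∑ v, G.triangleWeight v ≤ 7 * Fintype.card V + 14 := by
  have hK := hG.cliqueFree_four hdeg hV
  have hsum := sum_le_sum fun v (_ : v ∈ univ) => hK.triangleWeight_le hdeg v
  simp only [sum_add_distrib, ← mul_sum, sum_card_adjacentNeighborPairs,
    G.sum_degrees_eq_twice_card_edges, sum_const, card_univ, smul_eq_mul] at hsum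
  have := hG.sum_degree_two_le hdeg (by omega)
  have := hG.six_mul_card_add_card_orderedTriangles_le hK hdeg
  -- The charges cancel, leaving `12W + 42m ≤ 63n + 7T` with `T = 6t`; add seven times `6n + T ≤ 6m
  -- + 6` and divide by 3.
  omega

lemma clusteringCoeff_eq_sum_triangleWeight (hdeg : ∀ v, G.degree v ≤ 3) :
    G.clusteringCoeff = (∑ v, G.triangleWeight v : ℕ) / (3 * (Fintype.card V : ℚ)) := by
  rw [clusteringCoeff, Nat.cast_sum]
  simp_rw [triangleWeight_eq hdeg, ← mul_sum]
  rw [mul_div_mul_left _ _ (by norm_num : (3 : ℚ) ≠ 0)]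
  ring

end

end SimpleGraph

theorem theorem2 {V : Type*} [Fintype V] [DecidableEq V]
    (G : SimpleGraph V) [DecidableRel G.Adj] (n : ℕ) (hn : Fintype.card V = n) (hn6 : 6 ≤ n)
    (hconn : G.Connected) (hsub : G.IsSubcubic) :
    (n ≡ 0 [MOD 4] → G.clusteringCoeff ≤ 7 / 12 + 12 / (12 * (n : ℚ))) ∧
    (n ≡ 1 [MOD 4] → G.clusteringCoeff ≤ 7 / 12 + 13 / (12 * (n : ℚ))) ∧
    (n ≡ 2 [MOD 4] → G.clusteringCoeff ≤ 7 / 12 + 14 / (12 * (n : ℚ))) ∧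
    (n ≡ 3 [MOD 4] → G.clusteringCoeff ≤ 7 / 12 + 11 / (12 * (n : ℚ))) := by
  have hdeg : ∀ v, G.degree v ≤ 3 := fun v => by convert hsub v
  have hmain := hconn.four_mul_sum_triangleWeight_le hdeg (by omega)
  rw [SimpleGraph.clusteringCoeff_eq_sum_triangleWeight hdeg, hn]
  rw [hn] at hmain
  generalize ∑ v, G.triangleWeight v = W at *
  have hpos : (0 : ℚ) < n := by exact_mod_cast (by omega : 0 < n)
  have key : ∀ c : ℕ, 4 * W ≤ 7 * n + c →
      (W : ℚ) / (3 * (n : ℚ)) ≤ 7 / 12 + (c : ℚ) / (12 * (n : ℚ)) := by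
    intro c hc
    have hc' : (4 * W : ℚ) ≤ 7 * n + c := by exact_mod_cast hc
    have heq : 7 / 12 + (c : ℚ) / (12 * (n : ℚ)) - (W : ℚ) / (3 * (n : ℚ)) =
        (7 * n + c - 4 * W) / (12 * n) := by
      field_simp
      ring
    rw [← sub_nonneg, heq]
    exact div_nonneg (by linarith) (by positivity)
  simp only [Nat.ModEq]
  -- Each constant is the largest `c ≤ 14` with `4 ∣ 7n + c`.
  exact ⟨fun h => by exact_mod_cast key 12 (by omega), fun h => by exact_mod_cast key 13 (by omega),
    fun h => by exact_mod_cast key 14 (by omega), fun h => by exact_mod_cast key 11 (by omega)⟩
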